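/- Let $n, s, k_A, k_B, \omega_A, \omega_B$ be nonnegative integers with $k_A \le k_B$, $n = k_A k_B + s$, $s \le k_A k_B$, $\omega_A \mid k_A$, $\omega_B \mid k_B$, $1 < \omega_A < k_A$, $1 < \omega_B < k_B$ and $$\omega_A\,\omega_B \;\ge\; \left\lceil \frac{k_A k_B (s+1)}{k_A k_B + s} \right\rceil .$$ A real matrix $\mathbf{A}$ is partitioned into $k_A$ block-columns $\mathbf{A}_0, \dots, \mathbf{A}_{k_A-1}$ of equal width, and a real matrix $\mathbf{B}$ with the same number of rows into $k_B$ block-columns $\mathbf{B}_0, \dots, \mathbf{B}_{k_B-1}$ of equal width. Let the coefficients $r^A_{i,q}$ ($0 \le i < n$, $0 \le q < k_A$) and $r^B_{i,q}$ ($0 \le i < n$, $0 \le q < k_B$) be i.i.d. real random variables with a continuous (atomless) distribution. For each device $W_i$, $0 \le i \le n-1$, define index sets $T_i \subseteq \{0,\dots,k_A-1\}$ and $S_i \subseteq \{0,\dots,k_B-1\}$ as follows: - if $i < k_A k_B$, then $T_i = \{i, i+1, \dots, i+\omega_A-1\}$ reduced modulo $k_A$ and $S_i = \{j, j+1, \dots,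 j+\omega_B-1\}$ reduced modulo $k_B$, where $j = \lfloor i/k_A \rfloor$; - if $i \ge k_A k_B$, then $T_i = \{\ell\omega_A, \ell\omega_A+1, \dots, (\ell+1)\omega_A-1\}$ reduced modulo $k_A$, where $\ell = i \bmod k_A$, and $S_i = \{m\omega_B, m\omega_B+1, \dots, (m+1)\omega_B-1\}$ reduced modulo $k_B$, where $m = \lfloor i\,\omega_A/k_A \rfloor$. Device $W_i$ is assigned $\tilde{\mathbf{A}}_i = \sum_{q \in T_i} r^A_{i,q} \mathbf{A}_q$ and $\tilde{\mathbf{B}}_i = \sum_{q \in S_i} r^B_{i,q} \mathbf{B}_q$ and returns $\tilde{\mathbf{A}}_i^T \tilde{\mathbf{B}}_i$. Then, almost surely, the scheme is resilient to $s = n - k_A k_B$ stragglers: whichever devices (at most $s$ of them) fail to return their results, there are decoding coefficients, depending only on the random coefficients and on the set of remaining devices and not on $\mathbf{A}$ and $\mathbf{B}$, such that for all $\mathbf{A}$ and $\mathbf{B}$ all $k_A k_B$ products $\mathbf{A}_u^T \mathbf{B}_v$, and hence $\mathbf{A}^T \mathbf{B}$, are obtained as linear combinations with these coefficients of the results returned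 by the remaining devices. In particular, $\mathbf{A}^T\mathbf{B}$ is recovered from the results of any $k_A k_B$ devices. -/

import Mathlib

open MeasureTheory ProbabilityTheory

namespace CodedMatMul

/-- The block-column with index `q` (counted from `0`) of a matrix whose `k * w` columns are
partitioned into `k` consecutive block-columns of width `w`: its column `c` is column `q * w + c`
of the matrix. -/
def blockCol {t k w : ℕ} (M : Matrix (Fin t) (Fin (k * w)) ℝ) (q : Fin k) :
    Matrix (Fin t) (Fin w) ℝ :=
  M.submatrix id (fun c => finProdFinEquiv (q, c))

/-- The matrix which has `M u v` as its block in position `(u, v)`. -/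
def assemble {k l a b : ℕ} (M : Fin k → Fin l → Matrix (Fin a) (Fin b) ℝ) :
    Matrix (Fin (k * a)) (Fin (l * b)) ℝ :=
  fun x y => M (finProdFinEquiv.symm x).1 (finProdFinEquiv.symm y).1
    (finProdFinEquiv.symm x).2 (finProdFinEquiv.symm y).2

/-- The set `{start, start + 1, …, start + ω - 1}`, reduced modulo `k`. -/
def cyclicRange (k start ω : ℕ) : Finset (Fin k) :=
  Finset.univ.filter (fun q => ∃ e, e < ω ∧ (q : ℕ) = (start + e) % k)

/-- The set `T` of the indices of the block-columns of `A` that are combined for device `i`. -/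
def indicesA (kA kB ωA i : ℕ) : Finset (Fin kA) :=
  if i < kA * kB then cyclicRange kA i ωA
  else cyclicRange kA ((i % kA) * ωA) ωA

/-- The set `S` of the indices of the block-columns of `B` that are combined for device `i`.
The divisions are floor divisions. -/
def indicesB (kA kB ωA ωB i : ℕ) : Finset (Fin kB) :=
  if i < kA * kB then cyclicRange kB (i / kA) ωB
  else cyclicRange kB ((i * ωA / kA) * ωB) ωB

/-- The encoded submatrix of `A` assigned to device `i`; `RA` holds the coefficients. -/
def encodedA {n kA t a : ℕ} (kB ωA : ℕ) (RA : Matrix (Fin n) (Fin kA) ℝ)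
    (A : Matrix (Fin t) (Fin (kA * a)) ℝ) (i : Fin n) : Matrix (Fin t) (Fin a) ℝ :=
  ∑ q ∈ indicesA kA kB ωA i, RA i q • blockCol A q

/-- The encoded submatrix of `B` assigned to device `i`; `RB` holds the coefficients. -/
def encodedB {n kB t b : ℕ} (kA ωA ωB : ℕ) (RB : Matrix (Fin n) (Fin kB) ℝ)
    (B : Matrix (Fin t) (Fin (kB * b)) ℝ) (i : Fin n) : Matrix (Fin t) (Fin b) ℝ :=
  ∑ q ∈ indicesB kA kB ωA ωB i, RB i q • blockCol B q

/-- The product computed and returned by device `i`. -/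
def deviceResult {n kA kB t a b : ℕ} (ωA ωB : ℕ)
    (RA : Matrix (Fin n) (Fin kA) ℝ) (RB : Matrix (Fin n) (Fin kB) ℝ)
    (A : Matrix (Fin t) (Fin (kA * a)) ℝ) (B : Matrix (Fin t) (Fin (kB * b)) ℝ)
    (i : Fin n) : Matrix (Fin a) (Fin b) ℝ :=
  (encodedA kB ωA RA A i).transpose * encodedB kA ωA ωB RB B i

/-- The server can recover the product from the results of the devices in `F` alone: there are
decoding coefficients `d`, which do not depend on the data `A` and `B` (nor on their sizes), such
that each unknown `A_uᵀ B_v` is the combination of the returned results with coefficients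
`d u v`, and such that `Aᵀ B` is assembled from these combinations. -/
def Recoverable {n kA kB : ℕ} (ωA ωB : ℕ)
    (RA : Matrix (Fin n) (Fin kA) ℝ) (RB : Matrix (Fin n) (Fin kB) ℝ)
    (F : Finset (Fin n)) : Prop :=
  ∃ d : Fin kA → Fin kB → Fin n → ℝ, ∀ (t a b : ℕ)
    (A : Matrix (Fin t) (Fin (kA * a)) ℝ) (B : Matrix (Fin t) (Fin (kB * b)) ℝ),
    (∀ u v, (blockCol A u).transpose * blockCol B v =
      ∑ i ∈ F, d u v i • deviceResult ωA ωB RA RB A B i) ∧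
    A.transpose * B =
      assemble (fun u v => ∑ i ∈ F, d u v i • deviceResult ωA ωB RA RB A B i)

/-- Resilience to `s` stragglers: whichever devices (at most `s` of them) fail to return their
results, the product is recoverable from the results of the others. -/
def ResilientTo {n kA kB : ℕ} (ωA ωB : ℕ)
    (RA : Matrix (Fin n) (Fin kA) ℝ) (RB : Matrix (Fin n) (Fin kB) ℝ) (s : ℕ) : Prop :=
  ∀ stragglers : Finset (Fin n), stragglers.card ≤ s →
    Recoverable ωA ωB RA RB stragglersᶜ

end CodedMatMul

/-!
The result of a device is a linear combination of the unknowns `A_uᵀ B_v`, whose coefficients are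
products of random coefficients that belong to this device only. Assume that the unknowns can be
matched with distinct surviving devices, each of which uses the unknown that it is matched with.
Then the determinant of the square system given by the matched devices is a nonzero polynomial in
the random coefficients, since it is `1` when every device keeps only its matched unknown
(`det_genericMatrix_ne_zero`). A nonzero polynomial in independent variables with an atomless law
is almost surely nonzero (`ae_eval_ne_zero_of_iIndepFun`), and then the inverse of the system
holds the decoding coefficients (`recoverable_of_det_ne_zero`). There are only finitely many sets
of stragglers.

By Hall's theorem, such matchings exist for all sets of at most `s` stragglers if every nonempty
set `Q` of unknowns is touched by at least `|Q| + s` devices (`card_add_le_card_touching`). View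
the unknowns as the points of the torus `ℤ/kA × ℤ/kB`, and let `ω = ωA ωB` and `β = kA kB / ω`.
The first `kA kB` devices are the translates of an `ωA × ωB` box, and the last `s` devices run
periodically through the `β` blocks that tile the torus.

* If some of the first `kA kB` devices misses `Q`, at least `|Q| + ω - 1` of them touch it
  (`card_add_mul_le_card_boxStartsMeeting`), and so do at least `⌊s/β⌋` of the last `s`. The
  weight condition says exactly that `ω - 1 + ⌊s/β⌋ ≥ s`.
* If all of the first `kA kB` devices touch `Q`, then each of the last `s` that misses `Q` has a
  block outside `Q`. As `s ≤ kA kB = ω β`, at most `ω` devices share a block, so there are at most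
  as many such devices as there are unknowns outside `Q`.
-/

namespace CodedMatMul

/-! ### Zero sets of polynomials under atomless product measures -/

/-- Induction on the number of variables: for almost all values of the last `m` variables the
leading coefficient in the first variable does not vanish, so only finitely many values of the
first variable are zeros. -/
theorem ae_eval_ne_zero (D : Measure ℝ) [IsProbabilityMeasure D] [NullSingletonClass D] :
    ∀ (m : ℕ) (p : MvPolynomial (Fin m) ℝ), p ≠ 0 →
      ∀ᵐ x ∂(Measure.pi fun _ : Fin m => D), MvPolynomial.eval x p ≠ 0 := by
  intro m
  induction m with
  | zero =>
    intro p hp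
    refine Filter.Eventually.of_forall fun x hx => hp ?_
    rw [MvPolynomial.eq_C_of_isEmpty p] at hx ⊢
    simpa using hx
  | succ m ih =>
    intro p hp
    set f := MvPolynomial.finSuccEquiv ℝ m p with hf
    have hf0 : f ≠ 0 := by simpa [hf] using hp
    have hlc : f.leadingCoeff ≠ 0 := by simpa using hf0
    have hmeas : MeasurableSet {z : ℝ × (Fin m → ℝ) | MvPolynomial.eval (Fin.cons z.1 z.2) p = 0} := by
      have hc : Continuous fun z : ℝ × (Fin m → ℝ) =>
          MvPolynomial.eval (Fin.cons z.1 z.2 : Fin (m + 1) → ℝ) p := by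
        refine (MvPolynomial.continuous_eval p).comp (continuous_pi fun i => ?_)
        refine Fin.cases ?_ (fun j => ?_) i
        · simpa using continuous_fst
        · exact (continuous_apply j).comp continuous_snd
      exact (isClosed_eq hc continuous_const).measurableSet
    have hprod : ∀ᵐ z ∂(D.prod (Measure.pi fun _ : Fin m => D)),
        MvPolynomial.eval (Fin.cons z.1 z.2 : Fin (m + 1) → ℝ) p ≠ 0 := by
      rw [ae_iff]
      simp only [not_not]
      rw [Measure.prod_apply_symm hmeas]
      refine (lintegral_congr_ae ?_).trans lintegral_zero
      filter_upwards [ih _ hlc] with x hx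
      -- for fixed `x` the bad values of the first variable are roots of a nonzero polynomial
      have hne : f.map (MvPolynomial.eval x) ≠ 0 := fun h => hx (by
        rw [Polynomial.leadingCoeff, ← Polynomial.coeff_map, h, Polynomial.coeff_zero])
      refine measure_mono_null (fun y hy => ?_) (Set.Finite.measure_zero
        (Polynomial.finite_setOfPred_isRoot hne) D)
      simpa [Polynomial.IsRoot, MvPolynomial.eval_eq_eval_mv_eval'] using hy
    have hmp := measurePreserving_piFinSuccAbove (fun _ : Fin (m + 1) => D) 0
    filter_upwards [hmp.quasiMeasurePreserving.ae hprod] with x hx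
    convert hx using 3
    simp [MeasurableEquiv.piFinSuccAbove, Fin.insertNthEquiv, Fin.cons_self_tail]

theorem ae_eval_ne_zero_of_iIndepFun {Ω ι : Type*} [MeasurableSpace Ω] [Fintype ι] {P : Measure Ω}
    [IsProbabilityMeasure P] {D : Measure ℝ} [NullSingletonClass D] {X : ι → Ω → ℝ}
    (hX : ∀ i, HasLaw (X i) D P) (hindep : iIndepFun X P) {p : MvPolynomial ι ℝ} (hp : p ≠ 0) :
    ∀ᵐ x ∂P, MvPolynomial.eval (fun i => X i x) p ≠ 0 := by
  cases isEmpty_or_nonempty ι with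
  | inl h =>
    refine Filter.Eventually.of_forall fun x hx => hp ?_
    rw [MvPolynomial.eq_C_of_isEmpty p] at hx ⊢
    simpa using hx
  | inr h =>
    obtain ⟨i₀⟩ := h
    have : IsProbabilityMeasure D := by
      rw [← (hX i₀).map_eq]
      exact Measure.isProbabilityMeasure_map (hX i₀).aemeasurable
    let e := (Fintype.equivFin ι).symm
    have hi : iIndepFun (fun j => X (e j)) P := hindep.precomp e.injective
    have hlaw := (iIndepFun_iff_map_fun_eq_pi_map fun j => (hX (e j)).aemeasurable).1 hi
    rw [show (fun j => P.map (X (e j))) = fun _ => D from funext fun j => (hX (e j)).map_eq]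
      at hlaw
    have hp' : MvPolynomial.rename e.symm p ≠ 0 := fun h =>
      hp (MvPolynomial.rename_injective _ e.symm.injective (by simpa using h))
    have hae := ae_eval_ne_zero D _ _ hp'
    rw [← hlaw] at hae
    filter_upwards [ae_of_ae_map (aemeasurable_pi_lambda _ fun j => (hX (e j)).aemeasurable) hae]
      with x hx
    rw [MvPolynomial.eval_rename] at hx
    convert hx using 3
    ext i
    simp

open Finset
/-! ### Expansion of cyclic intervals and boxes -/

/-- The points `x` of the cycle of length `k` for which the cyclic interval of length `ω` that
starts at `x` meets `X`. -/
def startsMeeting {k : ℕ} (ω : ℕ) (X : Finset (Fin k)) : Finset (Fin k) :=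
  univ.filter fun x => ∃ y ∈ X, y ∈ cyclicRange k x ω

theorem mem_startsMeeting {k ω : ℕ} [NeZero k] {X : Finset (Fin k)} {x : Fin k} :
    x ∈ startsMeeting ω X ↔ ∃ e < ω, x + Fin.ofNat k e ∈ X := by
  simp only [startsMeeting, cyclicRange, mem_filter, mem_univ, true_and]
  constructor
  · rintro ⟨y, hy, e, he, h⟩
    refine ⟨e, he, ?_⟩
    convert hy
    ext
    simp [Fin.val_add, h]
  · rintro ⟨e, he, h⟩
    exact ⟨_, h, e, he, by simp [Fin.val_add]⟩

/-- Lengthening the intervals by one adds at least one starting point, until all of them are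
reached. -/
theorem min_le_card_startsMeeting {k : ℕ} {X : Finset (Fin k)} (hX : X.Nonempty) (m : ℕ) :
    min k (X.card + m) ≤ (startsMeeting (m + 1) X).card := by
  obtain ⟨x₀, hx₀⟩ := hX
  have : NeZero k := ⟨by have := x₀.2; omega⟩
  have hmono : ∀ m, startsMeeting m X ⊆ startsMeeting (m + 1) X := fun m x hx => by
    rw [mem_startsMeeting] at hx ⊢
    obtain ⟨e, he, h⟩ := hx
    exact ⟨e, by omega, h⟩
  have hsub : X ⊆ startsMeeting 1 X := fun x hx =>
    mem_startsMeeting.2 ⟨0, by omega, by simpa using hx⟩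
  have hne : ∀ m, X ⊆ startsMeeting (m + 1) X := fun m => by
    induction m with
    | zero => exact hsub
    | succ m ih => exact ih.trans (hmono _)
  induction m with
  | zero => exact (min_le_right _ _).trans (card_le_card hsub)
  | succ m ih =>
    by_cases heq : startsMeeting (m + 1 + 1) X = startsMeeting (m + 1) X
    · -- a nonempty set closed under subtracting `1` is everything
      have hcl : ∀ x : Fin k, x + 1 ∈ startsMeeting (m + 1) X → x ∈ startsMeeting (m + 1) X := by
        intro x hx
        rw [← heq]
        rw [mem_startsMeeting] at hx ⊢
        obtain ⟨e, he, h⟩ := hx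
        refine ⟨e + 1, by omega, ?_⟩
        convert h using 1
        rw [show Fin.ofNat k (e + 1) = 1 + Fin.ofNat k e by ext; simp [Fin.val_add, add_comm]]
        exact (add_assoc _ _ _).symm
      have hall : ∀ j : ℕ, x₀ - Fin.ofNat k j ∈ startsMeeting (m + 1) X := fun j => by
        induction j with
        | zero => simpa using hne m hx₀
        | succ j ihj =>
          apply hcl
          convert ihj using 1
          have : Fin.ofNat k (j + 1) = Fin.ofNat k j + 1 := by
            ext; simp [Fin.val_add]
          rw [this]; abel
      have huniv : startsMeeting (m + 1) X = univ := by
        refine eq_univ_of_forall fun x => ?_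
        have := hall (x₀ - x).val
        simpa using this
      rw [heq, huniv]
      simp
    · have := card_lt_card ((hmono (m + 1)).ssubset_of_ne (Ne.symm heq))
      omega

theorem sum_eq_sum_card_lt {ι : Type*} [Fintype ι] (g : ι → ℕ) {a : ℕ} (hg : ∀ y, g y ≤ a) :
    ∑ y, g y = ∑ t ∈ range a, (univ.filter fun y => t < g y).card := by
  simp_rw [card_filter]
  rw [sum_comm]
  refine sum_congr rfl fun y _ => ?_
  rw [← card_filter]
  have : (range a).filter (fun t => t < g y) = range (g y) := by
    ext t; have := hg y; simp; omega
  rw [this, card_range]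

/-- The arithmetic core of the expansion of boxes. Here `h t` stands for the number of rows of a
set `Q ⊆ Fin (P + (m + 1)) × Fin b` with more than `t` elements, and `G t` for the same number for
the set of starting points of the boxes of size `(P + 1) × (q + 1)` that meet `Q`. The
subtraction in `h (t - P)` truncates on purpose: a nonempty row of `Q` gives a row with at least
`P + 1` elements. The first alternative says that every starting point is reached. -/
theorem layer_sum_bound {P q b m : ℕ} {h G : ℕ → ℕ} (hP : 1 ≤ P) (hq : 1 ≤ q) (hm : P + 1 ≤ m)
    (hb : 2 * (q + 1) ≤ b) (hanti : Antitone h) (h0 : 0 < h 0) (hhb : ∀ t, h t ≤ b)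
    (hG : ∀ t < P + (m + 1), 0 < h (t - P) → min b (h (t - P) + q) ≤ G t) :
    (P + (m + 1)) * b ≤ ∑ t ∈ range (P + (m + 1)), G t ∨
    (∑ t ∈ range (P + (m + 1)), h t) + (P + 1) * (q + 1) ≤
      (∑ t ∈ range (P + (m + 1)), G t) + 1 := by
  have hG1 : P * min b (h 0 + q) ≤ ∑ t ∈ range P, G t := by
    have := card_nsmul_le_sum (range P) G (min b (h 0 + q)) fun t ht => by
      have ht := mem_range.1 ht
      have := hG t (by omega)
      rw [show t - P = 0 by omega] at this
      exact this h0
    simpa using this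
  have hG2 : ∀ t < m + 1, 0 < h t → min b (h t + q) ≤ G (P + t) := fun t ht hpos => by
    have := hG (P + t) (by omega)
    rw [show P + t - P = t by omega] at this
    exact this hpos
  have hGh : ∀ t < m + 1, h t ≤ G (P + t) := fun t ht => by
    rcases Nat.eq_zero_or_pos (h t) with h' | h'
    · omega
    · have := hG2 t ht h'; have := hhb t; omega
  have hh2 : ∑ t ∈ range P, h (m + 1 + t) ≤ P * h m := by
    have := sum_le_card_nsmul (range P) (fun t => h (m + 1 + t)) (h m) fun t _ =>
      hanti (by omega)
    simpa using this
  have hsplit : ∑ t ∈ range (P + (m + 1)), h t =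
      ∑ t ∈ range (m + 1), h t + ∑ t ∈ range P, h (m + 1 + t) := by
    rw [add_comm P, sum_range_add]
  rw [sum_range_add, hsplit]
  have hm0 : h m ≤ h 0 := hanti (Nat.zero_le m)
  -- whether every row is reached at the lowest and at the highest relevant level decides the case
  by_cases hA : b ≤ h m + q
  · left
    have hge : ∀ t ∈ range (m + 1), b ≤ G (P + t) := fun t ht => by
      have ht := mem_range.1 ht
      have := hanti (show t ≤ m by omega)
      have := hG2 t ht (by omega)
      omega
    have := card_nsmul_le_sum _ _ _ hge
    simp only [card_range, smul_eq_mul] at this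
    rw [min_eq_left (by omega)] at hG1
    nlinarith
  right
  push Not at hA
  rcases Nat.eq_zero_or_pos (h m) with hz | hpos
  · rw [hz] at hh2
    by_cases hB : b ≤ h 0 + q
    · rw [min_eq_left hB] at hG1
      have := sum_le_sum fun t ht => hGh t (mem_range.1 ht)
      nlinarith
    · rw [min_eq_right (by omega)] at hG1
      have h1 := hG2 0 (by omega) h0
      rw [min_eq_right (by omega)] at h1
      rw [sum_range_succ', sum_range_succ' _ m]
      have := sum_le_sum (s := range m) (f := fun t => h (t + 1)) (g := fun t => G (P + (t + 1)))
        fun t ht => hGh (t + 1) (by have := mem_range.1 ht; omega)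
      nlinarith
  · by_cases hB : b ≤ h 0 + q
    · rw [min_eq_left hB] at hG1
      have h1 := hG2 m (by omega) hpos
      rw [min_eq_right (by omega)] at h1
      rw [sum_range_succ, sum_range_succ _ m]
      have := sum_le_sum (s := range m) (f := fun t => h t) (g := fun t => G (P + t))
        fun t ht => hGh t (by have := mem_range.1 ht; omega)
      nlinarith
    · rw [min_eq_right (by omega)] at hG1
      have := sum_le_sum (s := range (m + 1)) (f := fun t => h t + q) (g := fun t => G (P + t))
        fun t ht => by
          have ht := mem_range.1 ht
          have h1 := hanti (show t ≤ m by omega)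
          have h2 := hanti (Nat.zero_le t)
          have := hG2 t ht (by omega)
          omega
      rw [sum_add_distrib] at this
      simp only [sum_const, card_range, smul_eq_mul] at this
      have hle : P * h m ≤ P * h 0 := Nat.mul_le_mul_left _ hm0
      have : (P + 1) * q ≤ m * q := Nat.mul_le_mul_right _ hm
      nlinarith

theorem card_eq_sum_card_rows {a b : ℕ} (Q : Finset (Fin a × Fin b)) :
    Q.card = ∑ y, (univ.filter fun x => (x, y) ∈ Q).card := by
  simp_rw [card_filter]
  rw [sum_comm, ← Fintype.sum_prod_type', ← card_filter]
  simp

/-- The points `z` of the torus for which the box of size `p × q` with corner `z` meets `Q`. -/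
def boxStartsMeeting {a b : ℕ} (p q : ℕ) (Q : Finset (Fin a × Fin b)) : Finset (Fin a × Fin b) :=
  univ.filter fun z => ∃ u ∈ Q, u.1 ∈ cyclicRange a z.1 p ∧ u.2 ∈ cyclicRange b z.2 q

/-- A Kneser-type bound: at least `|Q| + p q - 1` boxes of size `p × q` meet a nonempty `Q`, unless
all of them do. The sides of the box are at most half of those of the torus; without this, unions
of whole rows would be counterexamples. The one-dimensional bound is applied within the rows, and
then to each set of rows with more than `t` elements. -/
theorem card_add_mul_le_card_boxStartsMeeting {a b p q : ℕ} (hp : 1 < p) (hq : 1 < q)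
    (hpa : 2 * p ≤ a) (hqb : 2 * q ≤ b) {Q : Finset (Fin a × Fin b)} (hQ : Q.Nonempty)
    (hN : boxStartsMeeting p q Q ≠ univ) :
    Q.card + p * q ≤ (boxStartsMeeting p q Q).card + 1 := by
  obtain ⟨P, rfl⟩ : ∃ P, p = P + 1 := ⟨p - 1, by omega⟩
  obtain ⟨q, rfl⟩ : ∃ q', q = q' + 1 := ⟨q - 1, by omega⟩
  obtain ⟨m, rfl⟩ : ∃ m, a = P + (m + 1) := ⟨a - P - 1, by omega⟩
  set N := boxStartsMeeting (P + 1) (q + 1) Q with hNdef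
  let f : Fin b → ℕ := fun y => (univ.filter fun x => (x, y) ∈ Q).card
  let w : Fin b → ℕ := fun y => (univ.filter fun x => (x, y) ∈ N).card
  let h : ℕ → ℕ := fun t => (univ.filter fun y => t < f y).card
  let G : ℕ → ℕ := fun t => (univ.filter fun y => t < w y).card
  have hf : Q.card = ∑ t ∈ range (P + (m + 1)), h t := by
    rw [card_eq_sum_card_rows]
    exact sum_eq_sum_card_lt f fun y => (card_le_univ _).trans (by simp)
  have hw : N.card = ∑ t ∈ range (P + (m + 1)), G t := by
    rw [card_eq_sum_card_rows]
    exact sum_eq_sum_card_lt w fun y => (card_le_univ _).trans (by simp)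
  have hlt : N.card < (P + (m + 1)) * b := by
    have := card_lt_univ_of_notMem (s := N) (x := (not_forall.1 (mt eq_univ_of_forall hN)).choose)
      (not_forall.1 (mt eq_univ_of_forall hN)).choose_spec
    simpa using this
  have key := layer_sum_bound (P := P) (q := q) (b := b) (m := m) (h := h) (G := G)
    (by omega) (by omega) (by omega) hqb
    (fun t t' htt => card_le_card fun y => by simp only [mem_filter]; grind)
    (by
      obtain ⟨⟨x, y⟩, hz⟩ := hQ
      exact card_pos.2 ⟨y, by simpa [f] using card_pos.2 ⟨x, by simpa using hz⟩⟩)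
    (fun t => (card_le_univ _).trans (by simp))
    (fun t ht hpos => by
      refine (min_le_card_startsMeeting (card_pos.1 hpos) q).trans (card_le_card fun y hy => ?_)
      simp only [startsMeeting, mem_filter, mem_univ, true_and] at hy ⊢
      obtain ⟨y', hy', hyy⟩ := hy
      have hne : 0 < f y' := by omega
      have h1 := min_le_card_startsMeeting (card_pos.1 hne) P
      have h2 : (startsMeeting (P + 1) (univ.filter fun x => (x, y') ∈ Q)).card ≤ w y := by
        refine card_le_card fun x hx => ?_
        simp only [startsMeeting, mem_filter, mem_univ, true_and, hNdef, boxStartsMeeting]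
          at hx ⊢
        obtain ⟨x', hx', hxx⟩ := hx
        exact ⟨(x', y'), hx', hxx, hyy⟩
      change min _ (f y' + P) ≤ _ at h1
      omega)
  omega
/-! ### Hall's condition for the assignment of the devices -/

/-- Device `i` combines block-column `u.1` of `A` and block-column `u.2` of `B`. -/
def Touches (kA kB ωA ωB i : ℕ) (u : Fin kA × Fin kB) : Prop :=
  u.1 ∈ indicesA kA kB ωA i ∧ u.2 ∈ indicesB kA kB ωA ωB i

theorem mem_cyclicRange_block {ω g r : ℕ} (hω : 0 < ω) (u : Fin (ω * g))
    (h : (u : ℕ) / ω = r) : u ∈ cyclicRange (ω * g) (r * ω) ω := by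
  simp only [cyclicRange, mem_filter, mem_univ, true_and]
  refine ⟨u % ω, Nat.mod_lt _ hω, ?_⟩
  rw [← h, Nat.div_add_mod', Nat.mod_eq_of_lt u.2]

theorem cyclicRange_mod (k i ω : ℕ) : cyclicRange k (i % k) ω = cyclicRange k i ω := by
  simp [cyclicRange]

theorem cyclicRange_mod_mul (g i ω : ℕ) :
    cyclicRange (ω * g) ((i % g) * ω) ω = cyclicRange (ω * g) (i * ω) ω := by
  rw [← cyclicRange_mod _ (i * ω), mul_comm i, Nat.mul_mod_mul_left, mul_comm ω (i % g)]

/-- With `kA = ωA * g` and `kB = ωB * h`, the index in `{0, …, g * h - 1}` of the block of size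
`ωA × ωB` that contains `u`; the blocks are counted with the coordinate for `A` varying fastest. -/
def blockCode {kA kB : ℕ} (ωA ωB g : ℕ) (u : Fin kA × Fin kB) : ℕ :=
  (u.1 : ℕ) / ωA + g * ((u.2 : ℕ) / ωB)

/-- The devices with index at least `kA * kB` run through the blocks periodically. -/
theorem touches_of_mod_eq {ωA ωB g h j : ℕ} (hA : 0 < ωA) (hB : 0 < ωB) (hg : 0 < g)
    {u : Fin (ωA * g) × Fin (ωB * h)} (hj : j % (g * h) = blockCode ωA ωB g u) :
    Touches (ωA * g) (ωB * h) ωA ωB ((ωA * g) * (ωB * h) + j) u := by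
  have hu1 : (u.1 : ℕ) / ωA < g := Nat.div_lt_of_lt_mul u.1.2
  rw [Nat.mod_mul, blockCode] at hj
  have h1 : (u.1 : ℕ) / ωA = j % g := by
    have := congrArg (· % g) hj
    simpa [Nat.mod_eq_of_lt hu1] using this.symm
  have h2 : (u.2 : ℕ) / ωB = j / g % h := by
    rw [h1] at hj
    exact (Nat.eq_of_mul_eq_mul_left hg (Nat.add_left_cancel hj)).symm
  have hdiv : (ωA * g * (ωB * h) + j) * ωA / (ωA * g) = ωA * (ωB * h) + j / g := by
    rw [mul_comm _ ωA, Nat.mul_div_mul_left _ _ hA,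
      show ωA * g * (ωB * h) = g * (ωA * (ωB * h)) by ring, Nat.mul_add_div hg]
  constructor
  · rw [indicesA, if_neg (by omega), show ωA * g * (ωB * h) + j = j + ωA * g * (ωB * h) by ring,
      Nat.add_mul_mod_self_left, ← cyclicRange_mod_mul, Nat.mod_mul_left_mod]
    exact mem_cyclicRange_block hA _ h1
  · rw [indicesB, if_neg (by omega), hdiv, ← cyclicRange_mod_mul,
      show ωA * (ωB * h) + j / g = j / g + h * (ωA * ωB) by ring, Nat.add_mul_mod_self_left]
    exact mem_cyclicRange_block hB _ h2

/-- The devices with index below `kA * kB` correspond to the corners of all boxes of size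
`ωA × ωB` on the torus. -/
theorem touches_of_mem_cyclicRange {kA kB ωA ωB : ℕ} {z u : Fin kA × Fin kB}
    (h : u.1 ∈ cyclicRange kA z.1 ωA ∧ u.2 ∈ cyclicRange kB z.2 ωB) :
    Touches kA kB ωA ωB (z.1 + kA * z.2) u := by
  obtain ⟨x, y⟩ := z
  have hx := x.2
  have hlt : (x : ℕ) + kA * y < kA * kB := by
    have : kA * (y + 1) ≤ kA * kB := Nat.mul_le_mul_left _ y.2
    rw [mul_add] at this
    omega
  constructor
  · rw [indicesA, if_pos hlt, ← cyclicRange_mod, Nat.add_mul_mod_self_left, cyclicRange_mod]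
    exact h.1
  · rw [indicesB, if_pos hlt, Nat.add_mul_div_left _ _ (by omega), Nat.div_eq_of_lt hx, zero_add]
    exact h.2

theorem blockCode_lt {ωA ωB g h : ℕ} (u : Fin (ωA * g) × Fin (ωB * h)) :
    blockCode ωA ωB g u < g * h := by
  have hu1 : (u.1 : ℕ) / ωA < g := Nat.div_lt_of_lt_mul u.1.2
  have hu2 : (u.2 : ℕ) / ωB + 1 ≤ h := Nat.div_lt_of_lt_mul u.2.2
  have := Nat.mul_le_mul_left g hu2
  rw [mul_add] at this
  rw [blockCode]
  omega

theorem card_le_mul_card_image_blockCode {ωA ωB g h : ℕ} (hA : 0 < ωA) (hB : 0 < ωB) (hg : 0 < g)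
    (Q : Finset (Fin (ωA * g) × Fin (ωB * h))) :
    Q.card ≤ ωA * ωB * (Q.image (blockCode ωA ωB g)).card := by
  refine card_le_mul_card_image _ _ fun c _ => ?_
  have hmaps : ((Q.filter fun u => blockCode ωA ωB g u = c).image
      fun u => ((u.1 : ℕ) % ωA, (u.2 : ℕ) % ωB)) ⊆ range ωA ×ˢ range ωB := by
    intro z
    simp only [mem_image, mem_product, mem_range]
    rintro ⟨u, -, rfl⟩
    exact ⟨Nat.mod_lt _ hA, Nat.mod_lt _ hB⟩
  have := card_le_card hmaps
  rwa [card_product, card_range, card_range, card_image_of_injOn] at this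
  intro u hu v hv huv
  have hu := (mem_filter.1 hu).2
  have hv := (mem_filter.1 hv).2
  simp only [Prod.mk.injEq] at huv
  rw [← hv] at hu
  simp only [blockCode] at hu
  have hu1 : (u.1 : ℕ) / ωA < g := Nat.div_lt_of_lt_mul u.1.2
  have hv1 : (v.1 : ℕ) / ωA < g := Nat.div_lt_of_lt_mul v.1.2
  have h1 : (u.1 : ℕ) / ωA = (v.1 : ℕ) / ωA := by
    have := congrArg (· % g) hu
    simpa [Nat.mod_eq_of_lt hu1, Nat.mod_eq_of_lt hv1] using this
  rw [h1] at hu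
  have h2 := Nat.eq_of_mul_eq_mul_left hg (Nat.add_left_cancel hu)
  ext
  · rw [← Nat.div_add_mod (u.1 : ℕ) ωA, h1, huv.1, Nat.div_add_mod]
  · rw [← Nat.div_add_mod (u.2 : ℕ) ωB, h2, huv.2, Nat.div_add_mod]

open Classical in
/-- Every nonempty set `Q` of unknowns is touched by at least `|Q| + s` devices, so that Hall's
condition survives the loss of any `s` of them. -/
theorem card_add_le_card_touching {ωA ωB g h s : ℕ} (hA : 1 < ωA) (hB : 1 < ωB)
    (hg : 1 < g) (hh : 1 < h) (hs : s ≤ (ωA * g) * (ωB * h))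
    (hw : s + 1 ≤ ωA * ωB + s / (g * h))
    {Q : Finset (Fin (ωA * g) × Fin (ωB * h))} (hQ : Q.Nonempty) :
    Q.card + s ≤ ((range ((ωA * g) * (ωB * h) + s)).filter
      fun i => ∃ u ∈ Q, Touches (ωA * g) (ωB * h) ωA ωB i u).card := by
  set K := (ωA * g) * (ωB * h) with hK
  obtain ⟨β, hβdef⟩ : ∃ β, β = g * h := ⟨_, rfl⟩
  have hβ : 0 < β := by rw [hβdef]; positivity
  rw [← hβdef] at hw
  set C := Q.image (blockCode ωA ωB g) with hC
  set N := boxStartsMeeting ωA ωB Q with hN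
  set J := (range s).filter fun j => j % β ∈ C with hJ
  have hsub : N.image (fun z => (z.1 : ℕ) + (ωA * g) * z.2) ∪ J.image (fun j => K + j) ⊆
      (range (K + s)).filter fun i => ∃ u ∈ Q, Touches (ωA * g) (ωB * h) ωA ωB i u := by
    intro i hi
    rw [mem_union, mem_image, mem_image] at hi
    rw [mem_filter, mem_range]
    rcases hi with ⟨z, hz, rfl⟩ | ⟨j, hj, rfl⟩
    · simp only [hN, boxStartsMeeting, mem_filter, mem_univ, true_and] at hz
      obtain ⟨u, hu, h12⟩ := hz
      refine ⟨?_, u, hu, touches_of_mem_cyclicRange h12⟩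
      have := Nat.mul_le_mul_left (ωA * g) z.2.2
      rw [Nat.succ_eq_add_one, mul_add] at this
      have := z.1.2
      omega
    · rw [hJ, mem_filter, mem_range, hC, mem_image] at hj
      obtain ⟨hjs, u, hu, hju⟩ := hj
      exact ⟨by omega, u, hu, touches_of_mod_eq (by omega) (by omega) (by omega)
        (hβdef ▸ hju.symm)⟩
  have hcard : N.card + J.card ≤ ((range (K + s)).filter
      fun i => ∃ u ∈ Q, Touches (ωA * g) (ωB * h) ωA ωB i u).card := by
    refine le_trans (le_of_eq ?_) (card_le_card hsub)
    rw [card_union_of_disjoint, card_image_of_injective _ (add_right_injective K),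
      card_image_of_injective]
    · intro z z' hz
      have h1 := z.1.2
      have h2 := z'.1.2
      simp only at hz
      have e1 : (z.1 : ℕ) = z'.1 := by
        have := congrArg (· % (ωA * g)) hz
        simpa [Nat.mod_eq_of_lt h1, Nat.mod_eq_of_lt h2] using this
      rw [e1] at hz
      have e2 := Nat.eq_of_mul_eq_mul_left (show 0 < ωA * g by omega) (Nat.add_left_cancel hz)
      exact Prod.ext (Fin.ext e1) (Fin.ext e2)
    · rw [disjoint_left]
      intro i hi hi'
      obtain ⟨z, -, rfl⟩ := mem_image.1 hi
      obtain ⟨j, -, hj⟩ := mem_image.1 hi'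
      have := Nat.mul_le_mul_left (ωA * g) z.2.2
      rw [Nat.succ_eq_add_one, mul_add] at this
      have := z.1.2
      omega
  refine le_trans ?_ hcard
  by_cases hfull : N = univ
  · -- the devices among the last `s` that miss `Q` belong to blocks that are disjoint from `Q`
    have hNc : N.card = K := by rw [hfull]; simp [hK]
    have hCle : C ⊆ range β := fun c hc => by
      obtain ⟨u, -, rfl⟩ := mem_image.1 hc
      exact mem_range.2 (hβdef ▸ blockCode_lt u)
    have hQC := card_le_mul_card_image_blockCode (by omega) (by omega) (by omega) Q
    have hJs : J.card + ((range s).filter fun j => ¬ j % β ∈ C).card = s := by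
      rw [hJ, card_filter_add_card_filter_not, card_range]
    have hmiss : ((range s).filter fun j => ¬ j % β ∈ C).card ≤
        ωA * ωB * (range β \ C).card := by
      refine card_le_mul_card_image_of_maps_to (f := fun j => j % β)
        (fun j hj => ?_) _ fun r _ => ?_
      · exact mem_sdiff.2 ⟨mem_range.2 (Nat.mod_lt _ hβ), (mem_filter.1 hj).2⟩
      · rw [← card_range (ωA * ωB)]
        refine card_le_card_of_injOn (fun j => j / β) (fun j hj => ?_) fun j hj j' hj' he => ?_
        · have : j < s := by simp at hj; omega
          refine mem_coe.2 (mem_range.2 (Nat.div_lt_of_lt_mul ?_))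
          calc j < K := by omega
            _ = β * (ωA * ωB) := by rw [hK, hβdef]; ring
        · have e1 : j % β = r := by simp at hj; tauto
          have e2 : j' % β = r := by simp at hj'; tauto
          simp only at he
          rw [← Nat.div_add_mod j β, he, e1, ← e2, Nat.div_add_mod]
    rw [card_sdiff_of_subset hCle, card_range] at hmiss
    have hCc := card_le_card hCle
    rw [card_range] at hCc
    obtain ⟨d, hd⟩ := Nat.exists_eq_add_of_le hCc
    have : K = ωA * ωB * C.card + ωA * ωB * d := by
      rw [← mul_add, ← hd, hK, hβdef]; ring
    rw [show β - C.card = d by omega] at hmiss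
    rw [← hC] at hQC
    omega
  · -- the block of a single element of `Q` already contributes `s / β` of the last `s` devices
    have hexp : Q.card + ωA * ωB ≤ N.card + 1 :=
      card_add_mul_le_card_boxStartsMeeting hA hB (by nlinarith) (by nlinarith) hQ hfull
    obtain ⟨u, hu⟩ := hQ
    have hr : blockCode ωA ωB g u < β := hβdef ▸ blockCode_lt u
    set r := blockCode ωA ωB g u with hrdef
    have hJge : s / β ≤ J.card := by
      rw [← card_range (s / β)]
      refine card_le_card_of_injOn (fun e => r + β * e) (fun e he => ?_) fun e _ e' _ hee => ?_
      · have he := mem_range.1 (mem_coe.1 he)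
        have h1 := Nat.mul_le_mul_left β (show e + 1 ≤ s / β from he)
        have h2 := Nat.mul_div_le s β
        rw [mul_add] at h1
        refine mem_coe.2 (mem_filter.2 ⟨mem_range.2 (by dsimp only; omega), ?_⟩)
        rw [Nat.add_mul_mod_self_left, Nat.mod_eq_of_lt hr]
        exact mem_image_of_mem _ hu
      · exact Nat.eq_of_mul_eq_mul_left hβ (Nat.add_left_cancel hee)
    omega
/-- By Hall's theorem, the unknowns can be matched with distinct surviving devices that touch
them. -/
theorem exists_matching {ωA ωB g h s n : ℕ} (hA : 1 < ωA) (hB : 1 < ωB)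
    (hg : 1 < g) (hh : 1 < h) (hs : s ≤ (ωA * g) * (ωB * h))
    (hw : s + 1 ≤ ωA * ωB + s / (g * h)) (hn : n = (ωA * g) * (ωB * h) + s)
    {stragglers : Finset (Fin n)} (hst : stragglers.card ≤ s) :
    ∃ τ : Fin (ωA * g) × Fin (ωB * h) → Fin n, Function.Injective τ ∧
      ∀ u, τ u ∈ stragglersᶜ ∧ Touches (ωA * g) (ωB * h) ωA ωB (τ u) u := by
  classical
  refine (Fintype.all_card_le_filter_rel_iff_exists_injective
    fun (u : Fin (ωA * g) × Fin (ωB * h)) (i : Fin n) =>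
      i ∈ stragglersᶜ ∧ Touches (ωA * g) (ωB * h) ωA ωB i u).1 fun Q => ?_
  rcases Q.eq_empty_or_nonempty with rfl | hQ
  · simp
  have h1 := card_add_le_card_touching hA hB hg hh hs hw hQ
  rw [← hn] at h1
  have h2 : ((range n).filter fun i => ∃ u ∈ Q, Touches (ωA * g) (ωB * h) ωA ωB i u) =
      (univ.filter fun i : Fin n => ∃ u ∈ Q, Touches (ωA * g) (ωB * h) ωA ωB i u).map
        Fin.valEmbedding := by
    ext i
    simp only [mem_filter, mem_range, mem_map, mem_univ, true_and, Fin.valEmbedding_apply]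
    exact ⟨fun hi => ⟨⟨i, hi.1⟩, hi.2, rfl⟩, by rintro ⟨i, hi, rfl⟩; exact ⟨i.2, hi⟩⟩
  rw [h2, card_map] at h1
  have h3 : (univ.filter fun i : Fin n => ∃ u ∈ Q, Touches (ωA * g) (ωB * h) ωA ωB i u) ⊆
      (univ.filter fun i : Fin n => ∃ u ∈ Q, i ∈ stragglersᶜ ∧
        Touches (ωA * g) (ωB * h) ωA ωB i u) ∪ stragglers := by
    intro i hi
    simp only [mem_union, mem_filter, mem_univ, true_and, mem_compl] at hi ⊢
    by_cases his : i ∈ stragglers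
    · exact Or.inr his
    · obtain ⟨u, hu, ht⟩ := hi
      exact Or.inl ⟨u, hu, his, ht⟩
  have h4 := (card_le_card h3).trans (card_union_le _ _)
  omega

/-! ### Decoding from a matching -/

open Classical in
/-- The coefficient of the unknown `A_{u.1}ᵀ B_{u.2}` in the result of device `i`. The
coefficients are taken in any commutative semiring, so that they may also be indeterminates. -/
noncomputable def resultCoeff {R : Type*} [CommSemiring R] {n kA kB : ℕ} (ωA ωB : ℕ)
    (a : Fin n × Fin kA → R) (b : Fin n × Fin kB → R) (i : Fin n) (u : Fin kA × Fin kB) : R :=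
  if Touches kA kB ωA ωB i u then a (i, u.1) * b (i, u.2) else 0

theorem deviceResult_eq_sum {n kA kB t a b : ℕ} (ωA ωB : ℕ)
    (RA : Matrix (Fin n) (Fin kA) ℝ) (RB : Matrix (Fin n) (Fin kB) ℝ)
    (A : Matrix (Fin t) (Fin (kA * a)) ℝ) (B : Matrix (Fin t) (Fin (kB * b)) ℝ) (i : Fin n) :
    deviceResult ωA ωB RA RB A B i =
      ∑ u : Fin kA × Fin kB, resultCoeff ωA ωB (fun c => RA c.1 c.2) (fun c => RB c.1 c.2) i u •
        ((blockCol A u.1).transpose * blockCol B u.2) := by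
  classical
  rw [deviceResult, encodedA, encodedB, Matrix.transpose_sum, Matrix.sum_mul]
  simp_rw [Matrix.mul_sum]
  rw [← sum_product']
  simp only [resultCoeff, ite_smul, zero_smul, Touches, ← mem_product]
  rw [← sum_filter]
  refine sum_congr (by ext; simp) fun u _ => ?_
  rw [Matrix.transpose_smul, Matrix.smul_mul, Matrix.mul_smul, smul_smul]

theorem transpose_mul_eq_assemble {t kA kB a b : ℕ}
    (A : Matrix (Fin t) (Fin (kA * a)) ℝ) (B : Matrix (Fin t) (Fin (kB * b)) ℝ) :
    A.transpose * B = assemble fun u v => (blockCol A u).transpose * blockCol B v := by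
  ext x y
  simp only [assemble, Matrix.mul_apply, Matrix.transpose_apply, blockCol, Matrix.submatrix_apply,
    id, Prod.mk.eta, Equiv.apply_symm_apply]

theorem recoverable_of_det_ne_zero {n kA kB ωA ωB : ℕ}
    {RA : Matrix (Fin n) (Fin kA) ℝ} {RB : Matrix (Fin n) (Fin kB) ℝ} {F : Finset (Fin n)}
    {τ : Fin kA × Fin kB → Fin n} (hτ : ∀ u, τ u ∈ F)
    (hdet : (Matrix.of fun w u =>
      resultCoeff ωA ωB (fun c => RA c.1 c.2) (fun c => RB c.1 c.2) (τ w) u).det ≠ 0) :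
    Recoverable ωA ωB RA RB F := by
  classical
  set M : Matrix (Fin kA × Fin kB) (Fin kA × Fin kB) ℝ := Matrix.of fun w u =>
    resultCoeff ωA ωB (fun c => RA c.1 c.2) (fun c => RB c.1 c.2) (τ w) u with hM
  have hinv : M⁻¹ * M = 1 := Matrix.nonsing_inv_mul _ (isUnit_iff_ne_zero.2 hdet)
  refine ⟨fun u v i => ∑ w with τ w = i, M⁻¹ (u, v) w, fun t a b A B => ?_⟩
  have key : ∀ u v, (blockCol A u).transpose * blockCol B v =
      ∑ i ∈ F, (∑ w with τ w = i, M⁻¹ (u, v) w) • deviceResult ωA ωB RA RB A B i := by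
    intro u v
    calc (blockCol A u).transpose * blockCol B v
        = ∑ z : Fin kA × Fin kB, (M⁻¹ * M) (u, v) z •
            ((blockCol A z.1).transpose * blockCol B z.2) := by
          simp [hinv, Matrix.one_apply]
      _ = ∑ w, M⁻¹ (u, v) w • deviceResult ωA ωB RA RB A B (τ w) := by
          simp_rw [Matrix.mul_apply, sum_smul, deviceResult_eq_sum, smul_sum, smul_smul]
          rw [sum_comm]
          rfl
      _ = ∑ i ∈ F, ∑ w with τ w = i, M⁻¹ (u, v) w • deviceResult ωA ωB RA RB A B (τ w) :=
          (sum_fiberwise_of_maps_to (fun w _ => hτ w) _).symm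
      _ = _ := by
          refine sum_congr rfl fun i _ => ?_
          rw [sum_smul]
          exact sum_congr rfl fun w hw => by rw [(mem_filter.1 hw).2]
  refine ⟨key, ?_⟩
  rw [transpose_mul_eq_assemble]
  congr 1
  funext u v
  exact key u v

/-- The square system that expresses the results of the devices `τ w` in the unknowns, with the
random coefficients replaced by indeterminates. -/
noncomputable def genericMatrix {n kA kB : ℕ} (ωA ωB : ℕ) (τ : Fin kA × Fin kB → Fin n) :
    Matrix (Fin kA × Fin kB) (Fin kA × Fin kB)
      (MvPolynomial ((Fin n × Fin kA) ⊕ (Fin n × Fin kB)) ℝ) :=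
  Matrix.of fun w u => resultCoeff ωA ωB (fun c => MvPolynomial.X (Sum.inl c))
    (fun c => MvPolynomial.X (Sum.inr c)) (τ w) u

theorem eval_det_genericMatrix {n kA kB : ℕ} (ωA ωB : ℕ) (τ : Fin kA × Fin kB → Fin n)
    (x : (Fin n × Fin kA) ⊕ (Fin n × Fin kB) → ℝ) :
    MvPolynomial.eval x (genericMatrix ωA ωB τ).det = (Matrix.of fun w u =>
      resultCoeff ωA ωB (fun c => x (Sum.inl c)) (fun c => x (Sum.inr c)) (τ w) u).det := by
  rw [RingHom.map_det]
  congr 1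
  ext w u
  simp only [genericMatrix, resultCoeff, RingHom.mapMatrix_apply, Matrix.map_apply, Matrix.of_apply]
  split_ifs <;> simp

/-- A matching specializes the generic system to the identity matrix. -/
theorem det_genericMatrix_ne_zero {n kA kB ωA ωB : ℕ} {τ : Fin kA × Fin kB → Fin n}
    (hτ : Function.Injective τ) (ht : ∀ u, Touches kA kB ωA ωB (τ u) u) :
    (genericMatrix ωA ωB τ).det ≠ 0 := by
  classical
  intro h0
  -- device `τ w` is given the indicator coefficients of its own unknown `w`
  let x : (Fin n × Fin kA) ⊕ (Fin n × Fin kB) → ℝ := Sum.elim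
    (fun c => if ∃ w, τ w = c.1 ∧ w.1 = c.2 then 1 else 0)
    (fun c => if ∃ w, τ w = c.1 ∧ w.2 = c.2 then 1 else 0)
  have := eval_det_genericMatrix ωA ωB τ x
  rw [h0, map_zero, show (Matrix.of fun w u => resultCoeff ωA ωB (fun c => x (Sum.inl c))
    (fun c => x (Sum.inr c)) (τ w) u) = 1 from ?_, Matrix.det_one] at this
  · exact zero_ne_one this
  · ext w u
    simp only [resultCoeff, x, Sum.elim_inl, Sum.elim_inr, Matrix.of_apply, hτ.eq_iff,
      exists_eq_left, Matrix.one_apply]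
    by_cases hwu : w = u
    · subst hwu
      simp [ht]
    · rw [Prod.ext_iff, not_and_or] at hwu
      rcases hwu with hwu | hwu <;> simp [hwu, Prod.ext_iff]

/-- The weight condition in integers: with `ω = ωA * ωB` and `ω * β` unknowns, each unknown occurs
in at least `ω + s / β` of the results, which has to exceed `s`. -/
theorem add_one_le_of_ceil_le {ω β s : ℕ} (hω : 0 < ω) (hβ : 0 < β)
    (h : ⌈((ω * β : ℕ) : ℝ) * (s + 1) / ((ω * β : ℕ) + s)⌉₊ ≤ ω) : s + 1 ≤ ω + s / β := by
  have hpos : (0 : ℝ) < (ω * β : ℕ) + s := by positivity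
  rw [Nat.ceil_le, div_le_iff₀ hpos] at h
  have h' : ω * β * (s + 1) ≤ ω * (ω * β + s) := by exact_mod_cast h
  have h2 : β * (s + 1) ≤ ω * β + s := by
    refine Nat.le_of_mul_le_mul_left ?_ hω
    linarith
  have : s + 1 - ω ≤ s / β := by
    rw [Nat.le_div_iff_mul_le hβ, Nat.sub_mul]
    have := mul_comm β (s + 1)
    omega
  omega

end CodedMatMul

theorem theorem2 {Ω : Type*} [MeasurableSpace Ω] (P : Measure Ω) [IsProbabilityMeasure P]
    (D : Measure ℝ) [NullSingletonClass D]
    (n s kA kB ωA ωB : ℕ)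
    (hkAB : kA ≤ kB) (hn : n = kA * kB + s) (hs : s ≤ kA * kB)
    (hωA : 1 < ωA) (hωA' : ωA < kA) (hdvdA : ωA ∣ kA)
    (hωB : 1 < ωB) (hωB' : ωB < kB) (hdvdB : ωB ∣ kB)
    (hweight : ⌈((kA : ℝ) * kB * (s + 1)) / ((kA : ℝ) * kB + s)⌉₊ ≤ ωA * ωB)
    (RA : Fin n → Fin kA → Ω → ℝ) (RB : Fin n → Fin kB → Ω → ℝ)
    (hRA : ∀ i q, HasLaw (RA i q) D P) (hRB : ∀ i q, HasLaw (RB i q) D P)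
    (hindep : iIndepFun (Sum.elim (fun c : Fin n × Fin kA => RA c.1 c.2)
      (fun c : Fin n × Fin kB => RB c.1 c.2)) P) :
    ∀ᵐ x ∂P, CodedMatMul.ResilientTo ωA ωB
      (Matrix.of (fun i q => RA i q x)) (Matrix.of (fun i q => RB i q x)) s := by
  obtain ⟨g, rfl⟩ := hdvdA
  obtain ⟨h, rfl⟩ := hdvdB
  have hg : 1 < g := by by_contra hc; interval_cases g <;> omega
  have hh : 1 < h := by by_contra hc; interval_cases h <;> omega
  have hw : s + 1 ≤ ωA * ωB + s / (g * h) := by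
    refine CodedMatMul.add_one_le_of_ceil_le (by positivity) (by positivity) ?_
    convert hweight using 3 <;> push_cast <;> ring
  have hlaw : ∀ c, HasLaw (Sum.elim (fun c : Fin n × Fin (ωA * g) => RA c.1 c.2)
      (fun c : Fin n × Fin (ωB * h) => RB c.1 c.2) c) D P := by
    rintro (c | c)
    · exact hRA _ _
    · exact hRB _ _
  unfold CodedMatMul.ResilientTo
  rw [ae_all_iff]
  intro stragglers
  by_cases hst : stragglers.card ≤ s
  swap
  · exact Filter.Eventually.of_forall fun x hx => absurd hx hst
  obtain ⟨τ, hτ, hτF⟩ := CodedMatMul.exists_matching hωA hωB hg hh hs hw hn hst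
  filter_upwards [CodedMatMul.ae_eval_ne_zero_of_iIndepFun hlaw hindep
    (CodedMatMul.det_genericMatrix_ne_zero hτ fun u => (hτF u).2)] with x hx _
  rw [CodedMatMul.eval_det_genericMatrix] at hx
  exact CodedMatMul.recoverable_of_det_ne_zero (fun u => (hτF u).1) hx
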